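/- Let $n,m,r,t,d,L$ be nonnegative integers and $\varepsilon>0$. Let $C:\{0,1\}^n\to\{0,1\}^{\bar n}$, $\bar n=2^t$, be a code that is $(\varepsilon^2/(8m^2),L)$-list-decodable, i.e. every Hamming ball of relative radius $1/2-\varepsilon^2/(8m^2)$ in $\{0,1\}^{\bar n}$ contains at most $L$ codewords; label the positions of a codeword by $\{0,1\}^t$ and write $C(x)_y$ for the bit of $C(x)$ at position $y\in\{0,1\}^t$. Let $S_1,\dots,S_m\subseteq[d]$ be a weak $(t,r,m,d)$-design, i.e. $|S_i|=t$ and $\sum_{j<i}2^{|S_j\cap S_i|}\le rm$ for all $i$, and let $$Ext_C:\{0,1\}^n\times\{0,1\}^d\to\{0,1\}^m,\qquad Ext_C(x,y)=C(x)_{y_{S_1}},\dots,C(x)_{y_{S_m}},$$ where $y_{S}$ is the substring of $y$ at the positions in $S$. Let $\rho_{XE}=\sum_x p_x\,|x\rangle\langle x|\otimes\rho_x$ be a classical-quantum state, where $p$ is a probability distribution on $\{0,1\}^n$ and the $\rho_x$ are density matrices on a finite-dimensional system $E$. Let $Y$ be uniform on $\{0,1\}^d$ and independent of $XE$, and suppose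 that $$\big\|\rho_{Ext_C(X,Y)YE}-\rho_{U_m}\otimes\rho_Y\otimes\rho_E\big\|_1>\varepsilon,$$ where $\|A\|_1=\mathrm{Tr}\sqrt{AA^\dagger}$ and $\rho_{U_m}$ is the fully mixed state of dimension $2^m$. Then there are fixed strings $y_1,\dots,y_{rm}\in\{0,1\}^t$ and, for every $v\in\{0,1\}^{rm}$, a measurement (POVM) $\mathcal F^v$ on $E$ with outcomes in $\{0,1\}^{\bar n}$, such that the following holds. Draw $x\sim p$, give Eve, who holds $E$, the advice $v=(C(x)_{y_1},\dots,C(x)_{y_{rm}})$, and let $z$ be the outcome of $\mathcal F^{v}$ on $E$. Then, with probability at least $\varepsilon^2/(8m^2)$ over $x$ and the measurement outcome, $z$ is at relative Hamming distance at most $1/2-\varepsilon^2/(8m^2)$ from $C(x)$. In particular, if the encoding map $C$ is injective, there is a map that sends each $z\in\{0,1\}^{\bar n}$ to a list of $L$ strings in $\{0,1\}^n$ such that the list of $z$ contains every $x$ for which $z$ is at relative distance at most $1/2-\varepsilon^2/(8m^2)$ from $C(x)$; hence, with probability at least $\varepsilon^2/(8m^2)$, the list computed from Eve's outcome $z$ contains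 $x$. -/

import Mathlib

open scoped Kronecker BigOperators Matrix ComplexOrder

noncomputable section

/-- Bit strings of length `k`. -/
abbrev BitStr (k : ℕ) : Type := Fin k → Bool

/-! ### Codes and designs

A code `C : {0,1}^n → {0,1}^N` with `N = 2^t` has its codeword positions labelled by `{0,1}^t`,
so a codeword is a function `BitStr t → Bool`, and `C x y` is the bit of `C(x)` at position `y`. -/

/-- Relative Hamming distance of two strings whose positions are labelled by `ι`. -/
def relDist {ι : Type*} [Fintype ι] (z w : ι → Bool) : ℝ :=
  (hammingDist z w : ℝ) / (Fintype.card ι : ℝ)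

/-- `C` is `(δ, L)`-list-decodable: every Hamming ball of relative radius `1/2 - δ` contains at
most `L` codewords. -/
def IsListDecodable {n : ℕ} {ι : Type*} [Fintype ι] (C : BitStr n → (ι → Bool)) (δ : ℝ) (L : ℕ) :
    Prop :=
  ∀ z : ι → Bool, Set.ncard {c : ι → Bool | c ∈ Set.range C ∧ relDist z c ≤ 1 / 2 - δ} ≤ L

/-- `S_1, …, S_m ⊆ [d]` is a weak `(t, r, m, d)`-design: `|S_i| = t` and
`∑_{j < i} 2^{|S_j ∩ S_i|} ≤ r m` for all `i`. -/
structure IsWeakDesign (t r m d : ℕ) (S : Fin m → Finset (Fin d)) : Prop where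
  card_eq : ∀ i, (S i).card = t
  overlap_le : ∀ i, ∑ j ∈ Finset.univ.filter (fun j => j < i), 2 ^ (S j ∩ S i).card ≤ r * m

/-- The substring `y_S` of `y` at the positions in `S`, taken in increasing order. -/
def seedRestrict {d t : ℕ} (S : Finset (Fin d)) (hS : S.card = t) (y : BitStr d) : BitStr t :=
  fun k => y (S.orderEmbOfFin hS k)

/-- Trevisan's construction: `Ext_C(x, y) = C(x)_{y_{S_1}}, …, C(x)_{y_{S_m}}`. -/
def trevisanExt {n t r m d : ℕ} (C : BitStr n → (BitStr t → Bool)) {S : Fin m → Finset (Fin d)}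
    (hS : IsWeakDesign t r m d S) (x : BitStr n) (y : BitStr d) : BitStr m :=
  fun i => C x (seedRestrict (S i) (hS.card_eq i) y)

/-! ### Quantum states and measurements -/

/-- Density matrix: positive semidefinite of trace one. -/
structure IsDensityMatrix {E : Type*} [Fintype E] (σ : Matrix E E ℂ) : Prop where
  posSemidef : σ.PosSemidef
  trace_eq_one : σ.trace = 1

/-- Probability distribution on a finite set. -/
structure IsProbDist {X : Type*} [Fintype X] (p : X → ℝ) : Prop where
  nonneg : ∀ x, 0 ≤ p x
  sum_eq_one : ∑ x, p x = 1

/-- A measurement (POVM) on the system `E` with outcomes in `O`. -/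
structure IsPOVM {E O : Type*} [Fintype E] [DecidableEq E] [Fintype O]
    (F : O → Matrix E E ℂ) : Prop where
  posSemidef : ∀ o, (F o).PosSemidef
  sum_eq_one : ∑ o, F o = 1

/-- Schatten 1-norm `‖A‖₁ = Tr √(A A†)`, the sum of the square roots of the eigenvalues
of `A A†`. -/
def traceNorm {E : Type*} [Fintype E] [DecidableEq E] (A : Matrix E E ℂ) : ℝ :=
  ∑ i, √((Matrix.isHermitian_mul_conjTranspose_self A).eigenvalues i)

/-- The classical state `|a⟩⟨a|`. -/
def basisState {A : Type*} [DecidableEq A] (a : A) : Matrix A A ℂ := Matrix.single a a 1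

/-- The fully mixed state on `A`. -/
def maxMixed (A : Type*) [Fintype A] [DecidableEq A] : Matrix A A ℂ :=
  ((Fintype.card A : ℂ)⁻¹) • (1 : Matrix A A ℂ)

/-- The reduced state `ρ_E = ∑_x p_x ρ_x` of the classical-quantum state
`ρ_{XE} = ∑_x p_x |x⟩⟨x| ⊗ ρ_x`. -/
def reducedState {X E : Type*} [Fintype X] (p : X → ℝ) (ρ : X → Matrix E E ℂ) : Matrix E E ℂ :=
  ∑ x, (p x : ℂ) • ρ x

/-- The state `ρ_{f(X,Y) Y E}`, where `ρ_{XE} = ∑_x p_x |x⟩⟨x| ⊗ ρ_x` and `Y` is uniform on its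
range and independent of `XE`. -/
def extOutputState {X Y A E : Type*} [Fintype X] [Fintype Y] [DecidableEq Y] [DecidableEq A]
    (f : X → Y → A) (p : X → ℝ) (ρ : X → Matrix E E ℂ) : Matrix (A × (Y × E)) (A × (Y × E)) ℂ :=
  ∑ x, ∑ y, ((p x : ℂ) * (Fintype.card Y : ℂ)⁻¹) •
    (basisState (f x y) ⊗ₖ (basisState y ⊗ₖ ρ x))

open Classical in
/-- Eve holds system `E` of `ρ_{XE} = ∑_x p_x |x⟩⟨x| ⊗ ρ_x`, receives the advice `adv x` and then
performs the measurement `F (adv x)` on `E`. This is the probability, over `x ∼ p` and the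
measurement outcome `o`, that `event x o` holds. -/
def eveProb {X V O E : Type*} [Fintype X] [Fintype O] [Fintype E]
    (p : X → ℝ) (ρ : X → Matrix E E ℂ) (adv : X → V) (F : V → O → Matrix E E ℂ)
    (event : X → O → Prop) : ℝ :=
  ∑ x, ∑ o, if event x o then p x * ((F (adv x) o * ρ x).trace).re else 0

end

/-!
The proof turns a distinguisher for the extractor into a single measurement on `E` that predicts
all bits of `C x` at once.

*Hybrid argument.* The trace norm of the difference of the two states is its pairing with one
contraction (`exists_contraction_traceNorm_eq`). Both states are classical outside `E`, so only the
diagonal blocks of that contraction matter, one contraction `K a y` on `E` for each extractor output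
`a` and seed `y` (`exists_block_contractions`). The deviation of `K a y` from its mean over `a` is
the sum over `i < m` of next-bit predictors, which are again contractions and depend on `a` only
through the bits before `i` (`sub_mean_eq_sum_bitPredictor`, `norm_bitPredictor_le_one`). Some step
`i` therefore predicts its bit with advantage above `ε / m`, and the seed can be fixed outside `S i`
so that this remains true for a uniform position `w` in the codeword. By the weak design property
the earlier bits are then read from at most `r * m` fixed positions of the codeword; these are the
advice (`exists_advice_predictor`).

*Pretty good measurement.* The predictor above still depends on the position `w`. For fixed advice,
let `τ x` be the weighted states compatible with it and let `σ` be their sum. The measurement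
`σ^{-1/2} τ x σ^{-1/2}` does not depend on `w`; outcome `x` is turned into the string `C x`. With
`Δ = ∑ x, ± τ x`, its correlation with the bit at `w` is `Tr (σ^{-1/2} Δ σ^{-1/2} Δ)`, and in an
eigenbasis of `σ` the Cauchy–Schwarz inequality bounds this below by `(Tr (Δ K))² / Tr σ` for every
contraction `K` (`sq_re_trace_mul_le`, `exists_povm_sq_le`). A second Cauchy–Schwarz inequality,
over advice and positions, shows that the outcome `z` has expected correlation at least `(ε / m)²`
with `C x` (`exists_povm_sq_le_correlation`).

*Averaging.* The correlation of `z` and `C x` is `1 - 2 · relDist z (C x)`, at most `1` always and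
below `2 δ` off the event `relDist z (C x) ≤ 1/2 - δ`. With `δ = ε² / (8 m²)` the expected
correlation is at least `8 δ`, so the event has probability at least `δ`
(`le_eveProb_of_le_correlation`).
-/

/-! ### The trace norm and the pretty good measurement -/

section LinearAlgebra

open scoped Matrix.Norms.L2Operator

theorem Matrix.l2_opNorm_unitary_conj {E : Type*} [Fintype E] [DecidableEq E]
    (U : Matrix.unitaryGroup E ℂ) (M : Matrix E E ℂ) :
    ‖(U : Matrix E E ℂ) * M * (U : Matrix E E ℂ)ᴴ‖ = ‖M‖ := by
  rw [← Matrix.star_eq_conjTranspose, ← Unitary.coe_star, CStarRing.norm_mul_coe_unitary,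
    CStarRing.norm_coe_unitary_mul]

theorem Matrix.l2_opNorm_unitary_conj' {E : Type*} [Fintype E] [DecidableEq E]
    (U : Matrix.unitaryGroup E ℂ) (M : Matrix E E ℂ) :
    ‖(U : Matrix E E ℂ)ᴴ * M * (U : Matrix E E ℂ)‖ = ‖M‖ := by
  rw [← Matrix.star_eq_conjTranspose, ← Unitary.coe_star, CStarRing.norm_mul_coe_unitary,
    CStarRing.norm_coe_unitary_mul]

/-- Duality for the trace norm: it is attained as the pairing with a contraction. -/
theorem exists_contraction_traceNorm_eq {E : Type*} [Fintype E] [DecidableEq E]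
    (A : Matrix E E ℂ) : ∃ K : Matrix E E ℂ, ‖K‖ ≤ 1 ∧ traceNorm A = ((A * K).trace).re := by
  set h := Matrix.isHermitian_mul_conjTranspose_self A
  set U : Matrix E E ℂ := (h.eigenvectorUnitary : Matrix E E ℂ) with hU
  have hUU : Uᴴ * U = 1 := Unitary.coe_star_mul_self h.eigenvectorUnitary
  set l := h.eigenvalues
  have hl0 : ∀ i, 0 ≤ l i := (Matrix.posSemidef_self_mul_conjTranspose A).eigenvalues_nonneg
  have hspec : A * Aᴴ = U * Matrix.diagonal (fun i => (l i : ℂ)) * Uᴴ := by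
    have := h.spectral_theorem
    rw [Unitary.conjStarAlgAut_apply] at this
    exact this
  set D : Matrix E E ℂ := Matrix.diagonal (fun i => (((√(l i))⁻¹ : ℝ) : ℂ)) with hD
  have hDH : Dᴴ = D := by
    rw [hD, Matrix.diagonal_conjTranspose]; congr 1; ext i; simp
  -- The contraction of the polar decomposition, `K = A† (A A†)^{-1/2}`, with the inverse taken
  -- on the support of `A A†` because `0⁻¹ = 0`.
  refine ⟨Aᴴ * U * D * Uᴴ, ?_, ?_⟩
  · have h1 : (Aᴴ * U * D * Uᴴ)ᴴ * (Aᴴ * U * D * Uᴴ)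
        = U * Matrix.diagonal (fun i => ((((√(l i))⁻¹ * l i * (√(l i))⁻¹ : ℝ)) : ℂ)) * Uᴴ := by
      have : (Aᴴ * U * D * Uᴴ)ᴴ * (Aᴴ * U * D * Uᴴ) = U * D * Uᴴ * (A * Aᴴ) * U * D * Uᴴ := by
        simp only [Matrix.conjTranspose_mul, Matrix.conjTranspose_conjTranspose, hDH,
          Matrix.mul_assoc]
      rw [this, hspec]
      have : U * D * Uᴴ * (U * Matrix.diagonal (fun i => (l i : ℂ)) * Uᴴ) * U * D * Uᴴ
          = U * (D * ((Uᴴ * U) * Matrix.diagonal (fun i => (l i : ℂ)) * (Uᴴ * U)) * D) * Uᴴ := by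
        simp only [Matrix.mul_assoc]
      rw [this, hUU, Matrix.one_mul, Matrix.mul_one, hD, Matrix.diagonal_mul_diagonal,
        Matrix.diagonal_mul_diagonal]
      congr 3; ext i; push_cast; ring
    have h2 : ‖(Aᴴ * U * D * Uᴴ)ᴴ * (Aᴴ * U * D * Uᴴ)‖ ≤ 1 := by
      rw [h1]
      rw [Matrix.l2_opNorm_unitary_conj, Matrix.l2_opNorm_diagonal, pi_norm_le_iff_of_nonneg zero_le_one]
      intro i
      rw [Complex.norm_real, Real.norm_eq_abs]
      rcases (hl0 i).eq_or_lt with h0 | h0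
      · simp [← h0]
      · have hs : 0 < √(l i) := Real.sqrt_pos.2 h0
        have : (√(l i))⁻¹ * l i * (√(l i))⁻¹ = 1 := by
          field_simp
          rw [Real.sq_sqrt h0.le]
        rw [this]; simp
    rw [Matrix.l2_opNorm_conjTranspose_mul_self] at h2
    nlinarith [norm_nonneg (Aᴴ * U * D * Uᴴ)]
  · have : A * (Aᴴ * U * D * Uᴴ) = A * Aᴴ * U * D * Uᴴ := by simp only [Matrix.mul_assoc]
    rw [this, hspec, Matrix.trace_mul_comm]
    have : Uᴴ * (U * Matrix.diagonal (fun i => (l i : ℂ)) * Uᴴ * U * D)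
        = (Uᴴ * U) * Matrix.diagonal (fun i => (l i : ℂ)) * (Uᴴ * U) * D := by
      simp only [Matrix.mul_assoc]
    rw [this, hUU, Matrix.one_mul, Matrix.mul_one, hD, Matrix.diagonal_mul_diagonal,
      Matrix.trace_diagonal, Complex.re_sum]
    unfold traceNorm
    refine Finset.sum_congr rfl fun i _ => ?_
    rw [← Complex.ofReal_mul, Complex.ofReal_re, ← div_eq_mul_inv, Real.div_sqrt]

/-- A diagonal block of a contraction is a contraction. -/
theorem norm_submatrix_le_of_injective {E G : Type*} [Fintype E] [DecidableEq E] [Fintype G]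
    [DecidableEq G] (K : Matrix G G ℂ) (f : E → G) (hf : Function.Injective f) :
    ‖K.submatrix f f‖ ≤ ‖K‖ := by
  set P : Matrix G E ℂ := (1 : Matrix G G ℂ).submatrix id f with hP
  have h1 : Pᴴ * P = 1 := by
    ext i j
    simp [hP, Matrix.mul_apply, Matrix.one_apply, hf.eq_iff]
  have h2 : K.submatrix f f = Pᴴ * K * P := by
    ext i j
    simp [hP, Matrix.mul_apply, Matrix.one_apply]
  have h3 : ‖P‖ ≤ 1 := by
    have := Matrix.l2_opNorm_conjTranspose_mul_self P
    rw [h1] at this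
    have h4 : ‖(1 : Matrix E E ℂ)‖ ≤ 1 := by
      rw [← Matrix.diagonal_one, Matrix.l2_opNorm_diagonal]
      exact (pi_norm_le_iff_of_nonneg zero_le_one).2 fun i => by simp
    nlinarith [norm_nonneg P]
  rw [h2]
  calc ‖Pᴴ * K * P‖ ≤ ‖Pᴴ * K‖ * ‖P‖ := Matrix.l2_opNorm_mul _ _
    _ ≤ (‖Pᴴ‖ * ‖K‖) * ‖P‖ := by gcongr; exact Matrix.l2_opNorm_mul _ _
    _ ≤ (1 * ‖K‖) * 1 := by
        rw [Matrix.l2_opNorm_conjTranspose]; gcongr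
    _ = ‖K‖ := by ring

theorem sum_norm_sq_col_le_one {E : Type*} [Fintype E] [DecidableEq E] {K : Matrix E E ℂ}
    (hK : ‖K‖ ≤ 1) (j : E) : ∑ i, ‖K i j‖ ^ 2 ≤ 1 := by
  have h := Matrix.l2_opNorm_mulVec K (EuclideanSpace.single j (1 : ℂ))
  rw [PiLp.norm_single, norm_one, mul_one] at h
  have h2 : ‖(WithLp.toLp 2 (K *ᵥ (EuclideanSpace.single j (1 : ℂ)).ofLp) : EuclideanSpace ℂ E)‖ ^ 2
      = ∑ i, ‖K i j‖ ^ 2 := by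
    rw [EuclideanSpace.norm_sq_eq]
    simp
  rw [← h2]
  exact pow_le_one₀ (norm_nonneg _) (h.trans hK)

theorem sum_norm_sq_row_le_one {E : Type*} [Fintype E] [DecidableEq E] {K : Matrix E E ℂ}
    (hK : ‖K‖ ≤ 1) (i : E) : ∑ j, ‖K i j‖ ^ 2 ≤ 1 := by
  have := sum_norm_sq_col_le_one (K := Kᴴ) (by rwa [Matrix.l2_opNorm_conjTranspose]) i
  simpa [Matrix.conjTranspose_apply] using this

theorem Matrix.PosSemidef.apply_eq_zero_of_diag_eq_zero {E : Type*} [Fintype E] [DecidableEq E]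
    {M : Matrix E E ℂ} (hM : M.PosSemidef) {j : E} (hj : M j j = 0) (i : E) : M i j = 0 := by
  have h := (hM.dotProduct_mulVec_zero_iff (Pi.single j 1)).1 (by simp [hj])
  have := congrFun h i
  simpa using this

/-- Cauchy–Schwarz with weights `√(λ i λ j)`: a Hermitian matrix supported on the support of
`λ` pairs with a contraction to at most the square root of `(∑ λ) · Tr (Λ^{-1/2} Δ Λ^{-1/2} Δ)`. -/
theorem sq_re_trace_mul_le {E : Type*} [Fintype E] [DecidableEq E] {l : E → ℝ}
    (hl : ∀ i, 0 ≤ l i) {Δ K : Matrix E E ℂ}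
    (h0 : ∀ i j, l i = 0 ∨ l j = 0 → Δ i j = 0) (hK : ‖K‖ ≤ 1) :
    ((Δ * K).trace.re) ^ 2 ≤
      (∑ i, ∑ j, (√(l i))⁻¹ * (√(l j))⁻¹ * ‖Δ i j‖ ^ 2) * ∑ i, l i := by
  have hb : ∑ ij : E × E, √(l ij.1) * √(l ij.2) * ‖K ij.2 ij.1‖ ^ 2 ≤ ∑ i, l i := by
    calc ∑ ij : E × E, √(l ij.1) * √(l ij.2) * ‖K ij.2 ij.1‖ ^ 2
        ≤ ∑ ij : E × E, (l ij.1 / 2 * ‖K ij.2 ij.1‖ ^ 2 + l ij.2 / 2 * ‖K ij.2 ij.1‖ ^ 2) := by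
          refine Finset.sum_le_sum fun ij _ => ?_
          rw [← add_mul]
          gcongr
          nlinarith [sq_nonneg (√(l ij.1) - √(l ij.2)), Real.sq_sqrt (hl ij.1),
            Real.sq_sqrt (hl ij.2)]
      _ = (∑ i, l i / 2 * ∑ j, ‖K j i‖ ^ 2) + ∑ j, l j / 2 * ∑ i, ‖K j i‖ ^ 2 := by
          rw [Finset.sum_add_distrib, Fintype.sum_prod_type, Fintype.sum_prod_type_right]
          simp only [Finset.mul_sum]
      _ ≤ (∑ i, l i / 2 * 1) + ∑ j, l j / 2 * 1 := by
          gcongr with i _ j _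
          · have := hl i; positivity
          · exact sum_norm_sq_col_le_one hK i
          · have := hl j; positivity
          · exact sum_norm_sq_row_le_one hK j
      _ = ∑ i, l i := by rw [← Finset.sum_add_distrib]; exact Finset.sum_congr rfl fun i _ => by ring
  have ha : ∀ ij : E × E, 0 ≤ (√(l ij.1))⁻¹ * (√(l ij.2))⁻¹ * ‖Δ ij.1 ij.2‖ ^ 2 :=
    fun ij => by positivity
  have htr : (Δ * K).trace.re = ∑ ij : E × E, (Δ ij.1 ij.2 * K ij.2 ij.1).re := by
    rw [Fintype.sum_prod_type, Matrix.trace, Complex.re_sum]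
    exact Finset.sum_congr rfl fun i _ => by
      rw [Matrix.diag_apply, Matrix.mul_apply, Complex.re_sum]
  rw [htr]
  refine (Finset.sum_sq_le_sum_mul_sum_of_sq_le_mul Finset.univ (fun ij _ => ha ij)
    (g := fun ij : E × E => √(l ij.1) * √(l ij.2) * ‖K ij.2 ij.1‖ ^ 2)
    (fun ij _ => by positivity) fun ij _ => ?_).trans ?_
  · by_cases h : l ij.1 = 0 ∨ l ij.2 = 0
    · simp [h0 _ _ h]
    · push Not at h
      have h1 : √(l ij.1) ≠ 0 := (Real.sqrt_pos.2 ((hl _).lt_of_ne' h.1)).ne'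
      have h2 : √(l ij.2) ≠ 0 := (Real.sqrt_pos.2 ((hl _).lt_of_ne' h.2)).ne'
      have h3 : (√(l ij.1))⁻¹ * (√(l ij.2))⁻¹ * ‖Δ ij.1 ij.2‖ ^ 2 *
          (√(l ij.1) * √(l ij.2) * ‖K ij.2 ij.1‖ ^ 2) = ‖Δ ij.1 ij.2 * K ij.2 ij.1‖ ^ 2 := by
        rw [norm_mul]; field_simp
      rw [h3]
      exact sq_le_sq.2 (by rw [abs_of_nonneg (norm_nonneg _)]; exact Complex.abs_re_le_norm _)
  · rw [Fintype.sum_prod_type]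
    gcongr

/-- The bound for the pretty good measurement when the total state is diagonal. -/
theorem exists_povm_sq_le_of_sum_eq_diagonal {X E : Type*} [Fintype X] [Nonempty X] [Fintype E]
    [DecidableEq E] {τ : X → Matrix E E ℂ} (hτ : ∀ x, (τ x).PosSemidef) {l : E → ℝ}
    (hl : ∀ i, 0 ≤ l i) (hsum : ∑ x, τ x = Matrix.diagonal fun i => (l i : ℂ)) :
    ∃ G : X → Matrix E E ℂ, IsPOVM G ∧
      ∀ (s : X → ℝ) (K : Matrix E E ℂ), ‖K‖ ≤ 1 →
        (((∑ x, (s x : ℂ) • τ x) * K).trace.re) ^ 2 ≤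
          (∑ x, ∑ x', s x * s x' * (G x * τ x').trace.re) * (∑ x, τ x).trace.re ∧
        0 ≤ ∑ x, ∑ x', s x * s x' * (G x * τ x').trace.re := by
  classical
  obtain ⟨x₀⟩ := ‹Nonempty X›
  set Q : Matrix E E ℂ := Matrix.diagonal (fun i => (((√(l i))⁻¹ : ℝ) : ℂ)) with hQ
  set R : Matrix E E ℂ := Matrix.diagonal (fun i => if l i = 0 then (1 : ℂ) else 0) with hR
  have hQH : Qᴴ = Q := by
    rw [hQ, Matrix.diagonal_conjTranspose]; congr 1; ext i; simp
  have hdiag : ∀ i, l i = 0 → ∀ x, τ x i i = 0 := by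
    intro i hi
    have h1 : ∑ x, τ x i i = 0 := by
      have := congrFun (congrFun hsum i) i
      rw [Matrix.sum_apply, Matrix.diagonal_apply_eq, hi] at this
      simpa using this
    intro x
    exact (Finset.sum_eq_zero_iff_of_nonneg (fun x _ => (hτ x).diag_nonneg)).1 h1 x
      (Finset.mem_univ x)
  have hoff : ∀ i j, l i = 0 ∨ l j = 0 → ∀ x, τ x i j = 0 := by
    rintro i j (h | h) x
    · rw [← (hτ x).isHermitian.apply]
      simp [(hτ x).apply_eq_zero_of_diag_eq_zero (hdiag i h x) j]
    · exact (hτ x).apply_eq_zero_of_diag_eq_zero (hdiag j h x) i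
  have hRτ : ∀ x, R * τ x = 0 := by
    intro x; ext i j
    rw [hR, Matrix.diagonal_mul]
    split_ifs with h
    · simp [hoff i j (Or.inl h) x]
    · simp
  -- The kernel of the total state is assigned to an arbitrary outcome; it carries no weight.
  refine ⟨fun x => Q * τ x * Q + if x = x₀ then R else 0, ⟨fun x => ?_, ?_⟩, ?_⟩
  · have h1 : (Q * τ x * Q).PosSemidef := by
      have := (hτ x).mul_mul_conjTranspose_same Q
      rwa [hQH] at this
    refine h1.add ?_
    split_ifs
    · refine Matrix.PosSemidef.diagonal fun i => ?_
      show (0 : ℂ) ≤ if l i = 0 then 1 else 0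
      split_ifs <;> simp
    · exact Matrix.PosSemidef.zero
  · rw [Finset.sum_add_distrib, Finset.sum_ite_eq' Finset.univ x₀, if_pos (Finset.mem_univ _),
      ← Finset.sum_mul, ← Finset.mul_sum, hsum, hQ, hR, Matrix.diagonal_mul_diagonal,
      Matrix.diagonal_mul_diagonal, Matrix.diagonal_add, ← Matrix.diagonal_one]
    congr 1; ext i
    split_ifs with h
    · simp [h]
    · have hs : √(l i) ≠ 0 := (Real.sqrt_pos.2 ((hl _).lt_of_ne' h)).ne'
      rw [← Complex.ofReal_mul, ← Complex.ofReal_mul, add_zero]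
      norm_cast
      field_simp
      exact Real.sq_sqrt (hl i) |>.symm
  · intro s K hK
    set Δ := ∑ x, (s x : ℂ) • τ x with hΔ
    have hΔH : Δᴴ = Δ := by
      rw [hΔ, Matrix.conjTranspose_sum]
      refine Finset.sum_congr rfl fun x _ => ?_
      rw [Matrix.conjTranspose_smul, (hτ x).isHermitian.eq]; simp
    have h1 := sq_re_trace_mul_le hl (Δ := Δ) (K := K) (fun i j h => by
      rw [hΔ, Matrix.sum_apply]
      exact Finset.sum_eq_zero fun x _ => by rw [Matrix.smul_apply, hoff i j h x, smul_zero]) hK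
    have h2 : (∑ x, τ x).trace.re = ∑ i, l i := by
      rw [hsum, Matrix.trace_diagonal, Complex.re_sum]; simp
    have h3 : ∑ x, ∑ x', s x * s x' *
        ((Q * τ x * Q + if x = x₀ then R else 0) * τ x').trace.re = (Q * Δ * Q * Δ).trace.re := by
      have h4 : ∀ x x', (Q * τ x * Q + if x = x₀ then R else 0) * τ x' = Q * τ x * Q * τ x' := by
        intro x x'
        rw [Matrix.add_mul]
        split_ifs <;> simp [hRτ]
      simp only [h4]
      rw [hΔ]
      simp only [Finset.mul_sum, Finset.sum_mul, Matrix.trace_sum, Complex.re_sum]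
      rw [Finset.sum_comm]
      refine Finset.sum_congr rfl fun x _ => Finset.sum_congr rfl fun x' _ => ?_
      simp only [Matrix.mul_smul, Matrix.smul_mul, Matrix.trace_smul, smul_eq_mul,
        Complex.re_ofReal_mul]
      ring
    have h5 : (Q * Δ * Q * Δ).trace.re
        = ∑ i, ∑ j, (√(l i))⁻¹ * (√(l j))⁻¹ * ‖Δ i j‖ ^ 2 := by
      rw [Matrix.trace, Complex.re_sum]
      refine Finset.sum_congr rfl fun i _ => ?_
      rw [Matrix.diag_apply, Matrix.mul_apply, Complex.re_sum]
      refine Finset.sum_congr rfl fun j _ => ?_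
      have h6 : Δ j i = star (Δ i j) := by
        conv_lhs => rw [← hΔH]
        rfl
      rw [hQ, Matrix.mul_diagonal, Matrix.diagonal_mul, h6]
      have h7 : ((√(l i))⁻¹ : ℝ) * Δ i j * ((√(l j))⁻¹ : ℝ) * star (Δ i j)
          = ((((√(l i))⁻¹ * (√(l j))⁻¹ * ‖Δ i j‖ ^ 2 : ℝ)) : ℂ) := by
        have : Δ i j * star (Δ i j) = ((‖Δ i j‖ ^ 2 : ℝ) : ℂ) := by
          rw [← starRingEnd_apply, Complex.mul_conj, Complex.normSq_eq_norm_sq]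
        push_cast at this ⊢
        rw [← this]; ring
      rw [h7, Complex.ofReal_re]
    rw [h3, h5, h2]
    exact ⟨h1, Finset.sum_nonneg fun i _ => Finset.sum_nonneg fun j _ => by positivity⟩

/-- The pretty good measurement `G x = σ^{-1/2} τ x σ^{-1/2}` for `σ = ∑ x, τ x`. The one POVM
works for every `±1`-labelling `s`: the correlation of `s` at its outcome with `s` at the true
value is at least the square of what any contraction `K` achieves for that labelling, up to the
normalization `Tr σ`. The inverse is taken on the support of `σ`. -/
theorem exists_povm_sq_le {X E : Type*} [Fintype X] [Nonempty X] [Fintype E]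
    [DecidableEq E] {τ : X → Matrix E E ℂ} (hτ : ∀ x, (τ x).PosSemidef) :
    ∃ G : X → Matrix E E ℂ, IsPOVM G ∧
      ∀ (s : X → ℝ) (K : Matrix E E ℂ), ‖K‖ ≤ 1 →
        (((∑ x, (s x : ℂ) • τ x) * K).trace.re) ^ 2 ≤
          (∑ x, ∑ x', s x * s x' * (G x * τ x').trace.re) * (∑ x, τ x).trace.re ∧
        0 ≤ ∑ x, ∑ x', s x * s x' * (G x * τ x').trace.re := by
  have hσ : (∑ x, τ x).PosSemidef := Matrix.posSemidef_sum _ fun x _ => hτ x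
  set h := hσ.isHermitian
  set U : Matrix E E ℂ := (h.eigenvectorUnitary : Matrix E E ℂ) with hU
  have hUU : Uᴴ * U = 1 := Unitary.coe_star_mul_self h.eigenvectorUnitary
  have hUU' : U * Uᴴ = 1 := Unitary.coe_mul_star_self h.eigenvectorUnitary
  have hspec : ∑ x, τ x = U * Matrix.diagonal (fun i => (h.eigenvalues i : ℂ)) * Uᴴ := by
    have := h.spectral_theorem
    rw [Unitary.conjStarAlgAut_apply] at this
    exact this
  have hconj : ∀ A B : Matrix E E ℂ, ((Uᴴ * A * U) * (Uᴴ * B * U)).trace = (A * B).trace := by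
    intro A B
    have : (Uᴴ * A * U) * (Uᴴ * B * U) = Uᴴ * (A * (U * Uᴴ) * B * U) := by
      simp only [Matrix.mul_assoc]
    rw [this, hUU', Matrix.mul_one, Matrix.trace_mul_comm, Matrix.mul_assoc, hUU', Matrix.mul_one]
  have hτ' : ∀ x, (Uᴴ * τ x * U).PosSemidef := fun x => (hτ x).conjTranspose_mul_mul_same U
  have hsum' : ∑ x, Uᴴ * τ x * U = Matrix.diagonal (fun i => (h.eigenvalues i : ℂ)) := by
    rw [← Finset.sum_mul, ← Finset.mul_sum]
    refine (congrArg (fun M => Uᴴ * M * U) hspec).trans ?_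
    show Uᴴ * (U * Matrix.diagonal (fun i => (h.eigenvalues i : ℂ)) * Uᴴ) * U = _
    have : Uᴴ * (U * Matrix.diagonal (fun i => (h.eigenvalues i : ℂ)) * Uᴴ) * U
        = (Uᴴ * U) * Matrix.diagonal (fun i => (h.eigenvalues i : ℂ)) * (Uᴴ * U) := by
      simp only [Matrix.mul_assoc]
    rw [this, hUU, Matrix.one_mul, Matrix.mul_one]
  obtain ⟨G, hG, hle⟩ := exists_povm_sq_le_of_sum_eq_diagonal hτ' hσ.eigenvalues_nonneg hsum'
  refine ⟨fun x => U * G x * Uᴴ, ⟨fun x => (hG.posSemidef x).mul_mul_conjTranspose_same U, ?_⟩, ?_⟩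
  · rw [← Finset.sum_mul, ← Finset.mul_sum, hG.sum_eq_one, Matrix.mul_one, hUU']
  · intro s K hK
    have hK' : ‖Uᴴ * K * U‖ ≤ 1 := by
      rwa [Matrix.l2_opNorm_unitary_conj']
    have h1 := hle s (Uᴴ * K * U) hK'
    have h2 : ∑ x, (s x : ℂ) • (Uᴴ * τ x * U) = Uᴴ * (∑ x, (s x : ℂ) • τ x) * U := by
      simp only [Finset.mul_sum, Finset.sum_mul, Matrix.mul_smul, Matrix.smul_mul]
    have h3 : ∀ x x', (G x * (Uᴴ * τ x' * U)).trace = (U * G x * Uᴴ * τ x').trace := by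
      intro x x'
      rw [Matrix.mul_assoc (U * G x), Matrix.mul_assoc U, Matrix.trace_mul_comm U]
      simp only [Matrix.mul_assoc]
    have h4 : (∑ x, Uᴴ * τ x * U).trace = (∑ x, τ x).trace := by
      rw [← Finset.sum_mul, ← Finset.mul_sum, Matrix.trace_mul_comm, ← Matrix.mul_assoc, hUU',
        Matrix.one_mul]
    rw [h2, hconj, h4] at h1
    simpa only [h3] using h1

end LinearAlgebra

/-! ### The hybrid argument -/

/-- The sign `±1` of a bit. -/
def bitSign (b : Bool) : ℝ := if b then 1 else -1

/-- The string that agrees with `a` before position `i`, has bit `c` at `i` and agrees with `b`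
after `i`. -/
def hybridString {m : ℕ} (i : Fin m) (a b : BitStr m) (c : Bool) : BitStr m :=
  fun j => if j < i then a j else if j = i then c else b j

/-- The predictor of the `i`-th bit obtained from `g`, given the bits of `a` before position `i`:
half the difference of the values of `g` with the `i`-th bit set and unset, averaged over the
later bits. -/
noncomputable def bitPredictor {m : ℕ} {V : Type*} [AddCommGroup V] [Module ℝ V]
    (g : BitStr m → V) (i : Fin m) (a : BitStr m) : V :=
  (Fintype.card (BitStr m) : ℝ)⁻¹ • ∑ b, (2 : ℝ)⁻¹ •
    (g (hybridString i a b true) - g (hybridString i a b false))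

theorem bitPredictor_congr {m : ℕ} {V : Type*} [AddCommGroup V] [Module ℝ V]
    (g : BitStr m → V) (i : Fin m) {a a' : BitStr m} (h : ∀ j < i, a j = a' j) :
    bitPredictor g i a = bitPredictor g i a' := by
  have : ∀ b c, hybridString i a b c = hybridString i a' b c := by
    intro b c; ext j
    unfold hybridString
    split_ifs with hj
    · rw [h j hj]
    all_goals rfl
  simp only [bitPredictor, this]

theorem norm_bitPredictor_le_one {m : ℕ} {V : Type*} [NormedAddCommGroup V] [NormedSpace ℝ V]
    {g : BitStr m → V} (hg : ∀ a, ‖g a‖ ≤ 1) (i : Fin m) (a : BitStr m) :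
    ‖bitPredictor g i a‖ ≤ 1 := by
  unfold bitPredictor
  have h1 : ‖∑ b, (2 : ℝ)⁻¹ • (g (hybridString i a b true) - g (hybridString i a b false))‖
      ≤ Fintype.card (BitStr m) := by
    refine (norm_sum_le _ _).trans ?_
    have : ∑ _b : BitStr m, (1 : ℝ) = Fintype.card (BitStr m) := by simp
    rw [← this]
    refine Finset.sum_le_sum fun b _ => ?_
    rw [norm_smul, Real.norm_of_nonneg (by norm_num : (0 : ℝ) ≤ 2⁻¹)]
    have := norm_sub_le (g (hybridString i a b true)) (g (hybridString i a b false))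
    linarith [hg (hybridString i a b true), hg (hybridString i a b false)]
  have h2 : (0 : ℝ) < Fintype.card (BitStr m) := by exact_mod_cast Fintype.card_pos
  rw [norm_smul, norm_inv, Real.norm_of_nonneg h2.le, inv_mul_le_iff₀ h2, mul_one]
  exact h1

/-- Yao's hybrid decomposition: the deviation of `g` from its mean is the sum of its next-bit
predictors, each signed by the bit it predicts. -/
theorem sub_mean_eq_sum_bitPredictor {m : ℕ} {V : Type*} [AddCommGroup V] [Module ℝ V]
    (g : BitStr m → V) (a : BitStr m) :
    g a - (Fintype.card (BitStr m) : ℝ)⁻¹ • ∑ b, g b =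
      ∑ i, bitSign (a i) • bitPredictor g i a := by
  have hN : (Fintype.card (BitStr m) : ℝ) ≠ 0 := by exact_mod_cast Fintype.card_ne_zero
  set mix : ℕ → BitStr m → BitStr m := fun k b j => if (j : ℕ) < k then a j else b j with hmix
  have h0 : ∀ b, mix 0 b = b := fun b => by ext j; simp [hmix]
  have hm : ∀ b, mix m b = a := fun b => by ext j; simp [hmix]
  set H : ℕ → V := fun k => (Fintype.card (BitStr m) : ℝ)⁻¹ • ∑ b, g (mix k b) with hH
  have hHm : H m = g a := by
    simp only [hH, hm, Finset.sum_const, Finset.card_univ]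
    rw [← Nat.cast_smul_eq_nsmul ℝ, smul_smul, inv_mul_cancel₀ hN, one_smul]
  have hH0 : H 0 = (Fintype.card (BitStr m) : ℝ)⁻¹ • ∑ b, g b := by simp only [hH, h0]
  rw [← hH0, ← hHm, ← Finset.sum_range_sub, Finset.sum_range]
  refine Finset.sum_congr rfl fun i _ => ?_
  have hsucc : ∀ b, mix (i + 1) b = hybridString i a b (a i) := by
    intro b; ext j
    simp only [hmix, hybridString]
    rcases lt_trichotomy j i with h | h | h
    · rw [if_pos (by omega), if_pos h]
    · subst h; simp
    · rw [if_neg (by omega), if_neg (by omega), if_neg (by omega)]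
  have hself : ∀ b, mix i b = hybridString i a b (b i) := by
    intro b; ext j
    simp only [hmix, hybridString]
    rcases lt_trichotomy j i with h | h | h
    · rw [if_pos (by omega), if_pos h]
    · subst h; simp
    · rw [if_neg (by omega), if_neg (by omega), if_neg (by omega)]
  have hflip : ∀ b c, hybridString i a (Function.update b i (!b i)) c = hybridString i a b c := by
    intro b c; ext j
    simp only [hybridString]
    split_ifs with h1 h2
    · rfl
    · rfl
    · rw [Function.update_of_ne h2]
  have hinv : Function.Involutive fun b : BitStr m => Function.update b i (!b i) := by
    intro b; simp
  -- Averaging over the flip of bit `i` makes that bit uniform.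
  have hsym : ∑ b, g (mix i b) = ∑ b, (2 : ℝ)⁻¹ •
      (g (hybridString i a b true) + g (hybridString i a b false)) := by
    have h1 : ∑ b, g (mix i b) = ∑ b, g (mix i (Function.update b i (!b i))) :=
      (Equiv.sum_comp (hinv.toPerm _) fun b => g (mix i b)).symm
    have h2 : (2 : ℝ) • (∑ b, g (mix i b))
        = ∑ b, (g (hybridString i a b true) + g (hybridString i a b false)) := by
      rw [two_smul]
      nth_rewrite 2 [h1]
      rw [← Finset.sum_add_distrib]
      refine Finset.sum_congr rfl fun b _ => ?_
      rw [hself, hself, hflip, Function.update_self]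
      cases b i
      · exact add_comm _ _
      · rfl
    rw [← Finset.smul_sum, ← h2, smul_smul, inv_mul_cancel₀ two_ne_zero, one_smul]
  simp only [hH, bitPredictor]
  rw [hsym, ← smul_sub, ← Finset.sum_sub_distrib, smul_comm (bitSign (a i))]
  congr 1
  rw [Finset.smul_sum]
  refine Finset.sum_congr rfl fun b _ => ?_
  rw [hsucc]
  cases a i
  · rw [show bitSign false = -1 from rfl]; module
  · rw [show bitSign true = 1 from rfl]; module

/-! ### Seeds and advice strings -/

/-- Splits a seed into its substring at the positions in `S` and its remaining bits. -/
noncomputable def seedEquiv {d t : ℕ} (S : Finset (Fin d)) (hS : S.card = t) :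
    BitStr d ≃ BitStr t × ({k // k ∉ S} → Bool) :=
  (Equiv.piEquivPiSubtypeProd (· ∈ S) fun _ => Bool).trans
    (Equiv.prodCongr (Equiv.arrowCongr (S.orderIsoOfFin hS).toEquiv.symm (Equiv.refl _))
      (Equiv.refl _))

theorem seedEquiv_fst {d t : ℕ} (S : Finset (Fin d)) (hS : S.card = t) (y : BitStr d) :
    (seedEquiv S hS y).1 = seedRestrict S hS y := rfl

theorem seedEquiv_snd {d t : ℕ} (S : Finset (Fin d)) (hS : S.card = t) (y : BitStr d)
    (k : {k // k ∉ S}) : (seedEquiv S hS y).2 k = y k := rfl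

theorem seedRestrict_seedEquiv_symm {d t : ℕ} (S : Finset (Fin d)) (hS : S.card = t)
    (w : BitStr t) (u : {k // k ∉ S} → Bool) :
    seedRestrict S hS ((seedEquiv S hS).symm (w, u)) = w := by
  rw [← seedEquiv_fst, Equiv.apply_symm_apply]

theorem seedEquiv_symm_apply_of_notMem {d t : ℕ} (S : Finset (Fin d)) (hS : S.card = t)
    (w : BitStr t) (u : {k // k ∉ S} → Bool) {k : Fin d} (hk : k ∉ S) :
    (seedEquiv S hS).symm (w, u) k = u ⟨k, hk⟩ := by
  have := seedEquiv_snd S hS ((seedEquiv S hS).symm (w, u)) ⟨k, hk⟩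
  rw [Equiv.apply_symm_apply] at this
  exact this.symm

/-- The bits outside `S` can be fixed without decreasing the average. -/
theorem exists_lt_sum_of_lt_sum {d t : ℕ} (S : Finset (Fin d)) (hS : S.card = t) {c : ℝ}
    (h : BitStr d → ℝ)
    (hc : c < ∑ y, (Fintype.card (BitStr d) : ℝ)⁻¹ * h y) :
    ∃ u, c < ∑ w, (Fintype.card (BitStr t) : ℝ)⁻¹ * h ((seedEquiv S hS).symm (w, u)) := by
  by_contra! hcon
  have hcard : (Fintype.card (BitStr d) : ℝ)
      = Fintype.card (BitStr t) * Fintype.card ({k // k ∉ S} → Bool) := by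
    rw [Fintype.card_congr (seedEquiv S hS), Fintype.card_prod]; push_cast; rfl
  have hU : (0 : ℝ) < Fintype.card ({k // k ∉ S} → Bool) := by exact_mod_cast Fintype.card_pos
  have hsum : ∑ y, (Fintype.card (BitStr d) : ℝ)⁻¹ * h y
      = ∑ u, (Fintype.card ({k // k ∉ S} → Bool) : ℝ)⁻¹ *
        ∑ w, (Fintype.card (BitStr t) : ℝ)⁻¹ * h ((seedEquiv S hS).symm (w, u)) := by
    rw [← Equiv.sum_comp (seedEquiv S hS).symm, Fintype.sum_prod_type_right]
    refine Finset.sum_congr rfl fun u _ => ?_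
    rw [Finset.mul_sum]
    refine Finset.sum_congr rfl fun w _ => ?_
    rw [hcard, mul_inv]; ring
  have hle : ∑ y, (Fintype.card (BitStr d) : ℝ)⁻¹ * h y ≤ c := by
    rw [hsum]
    calc _ ≤ ∑ _u : {k // k ∉ S} → Bool, (Fintype.card ({k // k ∉ S} → Bool) : ℝ)⁻¹ * c := by
          gcongr with u _; exact hcon u
      _ = c := by
          rw [Finset.sum_const, Finset.card_univ, nsmul_eq_mul, mul_inv_cancel_left₀ hU.ne']
  exact absurd hc hle.not_gt

theorem Finset.exists_fin_fun_of_card_le {α : Type*} [Nonempty α] {N : ℕ} (A : Finset α)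
    (hA : A.card ≤ N) : ∃ y : Fin N → α, ∀ a ∈ A, ∃ q, y q = a := by
  classical
  obtain ⟨x₀⟩ := ‹Nonempty α›
  refine ⟨fun q => if h : (q : ℕ) < A.card then (A.equivFin.symm ⟨q, h⟩ : α) else x₀,
    fun a ha => ?_⟩
  refine ⟨Fin.castLE hA (A.equivFin ⟨a, ha⟩), ?_⟩
  simp

/-- With the bits outside `S i` fixed, the substrings at `S j` take at most `2 ^ |S j ∩ S i|`
values, so all positions of the codeword that are read before step `i` fit into a list of
`r * m` strings. -/
theorem IsWeakDesign.exists_advice {t r m d : ℕ} {S : Fin m → Finset (Fin d)}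
    (hS : IsWeakDesign t r m d S) (i : Fin m) (u : {k // k ∉ S i} → Bool) :
    ∃ y : Fin (r * m) → BitStr t, ∀ w, ∀ j < i, ∃ q, y q =
      seedRestrict (S j) (hS.card_eq j) ((seedEquiv (S i) (hS.card_eq i)).symm (w, u)) := by
  classical
  set e := seedEquiv (S i) (hS.card_eq i) with he
  set B : Fin m → Finset (BitStr t) := fun j =>
    Finset.univ.image fun w => seedRestrict (S j) (hS.card_eq j) (e.symm (w, u)) with hB
  have hBcard : ∀ j, (B j).card ≤ 2 ^ (S j ∩ S i).card := by
    intro j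
    set φ : ({k // k ∈ S j ∩ S i} → Bool) → BitStr t := fun g =>
      seedRestrict (S j) (hS.card_eq j) fun k =>
        if h : k ∈ S j ∩ S i then g ⟨k, h⟩ else e.symm (fun _ => false, u) k with hφ
    have hsub : B j ⊆ Finset.univ.image φ := by
      intro b hb
      obtain ⟨w, -, rfl⟩ := Finset.mem_image.1 hb
      refine Finset.mem_image.2 ⟨fun k => e.symm (w, u) k, Finset.mem_univ _, ?_⟩
      ext q
      simp only [hφ, seedRestrict]
      split_ifs with h
      · rfl
      · have hq : (S j).orderEmbOfFin (hS.card_eq j) q ∉ S i := fun hq =>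
          h (Finset.mem_inter.2 ⟨Finset.orderEmbOfFin_mem _ _ _, hq⟩)
        rw [he, seedEquiv_symm_apply_of_notMem _ _ _ _ hq,
          seedEquiv_symm_apply_of_notMem _ _ _ _ hq]
    calc (B j).card ≤ (Finset.univ.image φ).card := Finset.card_le_card hsub
      _ ≤ Fintype.card ({k // k ∈ S j ∩ S i} → Bool) := Finset.card_image_le
      _ = 2 ^ (S j ∩ S i).card := by
          rw [Fintype.card_fun, Fintype.card_bool, Fintype.card_coe]
  obtain ⟨y, hy⟩ := Finset.exists_fin_fun_of_card_le (N := r * m)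
    ((Finset.univ.filter fun j => j < i).biUnion B)
    (Finset.card_biUnion_le.trans ((Finset.sum_le_sum fun j _ => hBcard j).trans
      (hS.overlap_le i)))
  refine ⟨y, fun w j hj => hy _ ?_⟩
  exact Finset.mem_biUnion.2 ⟨j, by simpa using hj, Finset.mem_image_of_mem _ (Finset.mem_univ w)⟩

/-! ### From a distinguisher to a next-bit predictor -/

section Distinguisher

open scoped Matrix.Norms.L2Operator

/-- The block of `K` at the classical value `(a, y)`. -/
def classicalBlock {A Y E : Type*} (K : Matrix (A × (Y × E)) (A × (Y × E)) ℂ) (a : A) (y : Y) :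
    Matrix E E ℂ :=
  K.submatrix (fun e => (a, (y, e))) fun e => (a, (y, e))

theorem trace_basisState_kronecker_mul {A Y E : Type*} [Fintype A] [DecidableEq A] [Fintype Y]
    [DecidableEq Y] [Fintype E] (a : A) (y : Y) (M : Matrix E E ℂ)
    (K : Matrix (A × (Y × E)) (A × (Y × E)) ℂ) :
    ((basisState a ⊗ₖ (basisState y ⊗ₖ M)) * K).trace = (M * classicalBlock K a y).trace := by
  simp only [Matrix.trace, Matrix.diag_apply, Matrix.mul_apply, Fintype.sum_prod_type,
    Matrix.kroneckerMap_apply, basisState, Matrix.single_apply, classicalBlock,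
    Matrix.submatrix_apply, ite_mul, one_mul, zero_mul, ite_and, Finset.sum_ite_irrel,
    Finset.sum_const_zero, Finset.sum_ite_eq, Finset.mem_univ, if_true]

theorem trace_maxMixed_kronecker_mul {A Y E : Type*} [Fintype A] [DecidableEq A] [Fintype Y]
    [DecidableEq Y] [Fintype E] (M : Matrix E E ℂ)
    (K : Matrix (A × (Y × E)) (A × (Y × E)) ℂ) :
    ((maxMixed A ⊗ₖ (maxMixed Y ⊗ₖ M)) * K).trace =
      (Fintype.card A : ℂ)⁻¹ * ((Fintype.card Y : ℂ)⁻¹ *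
        ∑ a, ∑ y, (M * classicalBlock K a y).trace) := by
  rw [maxMixed, maxMixed, Matrix.smul_kronecker, Matrix.smul_kronecker, Matrix.kronecker_smul,
    Matrix.smul_mul, Matrix.smul_mul, Matrix.trace_smul, Matrix.trace_smul, smul_eq_mul,
    smul_eq_mul]
  congr 2
  simp only [Matrix.trace, Matrix.diag_apply, Matrix.mul_apply, Fintype.sum_prod_type,
    Matrix.kroneckerMap_apply, Matrix.one_apply, classicalBlock,
    Matrix.submatrix_apply, ite_mul, one_mul, zero_mul, Finset.sum_ite_irrel,
    Finset.sum_const_zero, Finset.sum_ite_eq, Finset.mem_univ, if_true]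

/-- Since both states are block diagonal in the classical registers, a trace distance above `ε` is
witnessed by one contraction on `E` for each classical value. -/
theorem exists_block_contractions {X Y A E : Type*} [Fintype X] [Fintype Y] [DecidableEq Y]
    [Fintype A] [DecidableEq A] [Fintype E] [DecidableEq E] {ε : ℝ}
    (f : X → Y → A) (p : X → ℝ) (ρ : X → Matrix E E ℂ)
    (hfar : ε < traceNorm (extOutputState f p ρ -
      maxMixed A ⊗ₖ (maxMixed Y ⊗ₖ reducedState p ρ))) :
    ∃ K : A → Y → Matrix E E ℂ, (∀ a y, ‖K a y‖ ≤ 1) ∧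
      ε < ∑ x, ∑ y, p x * (Fintype.card Y : ℝ)⁻¹ *
        (ρ x * (K (f x y) y - (Fintype.card A : ℝ)⁻¹ • ∑ a, K a y)).trace.re := by
  obtain ⟨K, hK, hKtr⟩ := exists_contraction_traceNorm_eq (extOutputState f p ρ -
      maxMixed A ⊗ₖ (maxMixed Y ⊗ₖ reducedState p ρ))
  refine ⟨classicalBlock K, fun a y => ?_, ?_⟩
  · exact (norm_submatrix_le_of_injective K _ fun e e' h => by simpa using h).trans hK
  · rw [hKtr, Matrix.sub_mul, Matrix.trace_sub, trace_maxMixed_kronecker_mul] at hfar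
    refine hfar.trans_eq ?_
    rw [Complex.sub_re, extOutputState, reducedState]
    have h1 : ∀ x, ∀ y, p x * (Fintype.card Y : ℝ)⁻¹ *
        (ρ x * (classicalBlock K (f x y) y -
          (Fintype.card A : ℝ)⁻¹ • ∑ a, classicalBlock K a y)).trace.re =
        p x * (Fintype.card Y : ℝ)⁻¹ * (ρ x * classicalBlock K (f x y) y).trace.re -
        (Fintype.card A : ℝ)⁻¹ * ((Fintype.card Y : ℝ)⁻¹ *
          ∑ a, p x * (ρ x * classicalBlock K a y).trace.re) := by
      intro x y
      rw [Matrix.mul_sub, Matrix.trace_sub, Complex.sub_re, Matrix.mul_smul, Matrix.trace_smul,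
        Complex.smul_re, Matrix.mul_sum, Matrix.trace_sum, Complex.re_sum, ← Finset.mul_sum,
        smul_eq_mul]
      ring
    simp only [h1, Finset.sum_sub_distrib]
    congr 1
    · simp only [Finset.sum_mul, Matrix.trace_sum, Complex.re_sum, Matrix.smul_mul,
        Matrix.trace_smul, trace_basisState_kronecker_mul, smul_eq_mul]
      refine Finset.sum_congr rfl fun x _ => Finset.sum_congr rfl fun y _ => ?_
      rw [← Complex.ofReal_natCast, ← Complex.ofReal_inv, ← Complex.ofReal_mul,
        Complex.re_ofReal_mul]
    · rw [← Complex.ofReal_natCast, ← Complex.ofReal_inv, Complex.re_ofReal_mul,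
        ← Complex.ofReal_natCast, ← Complex.ofReal_inv, Complex.re_ofReal_mul]
      simp only [← Finset.mul_sum]
      congr 2
      simp only [Finset.sum_mul, Matrix.trace_sum, Complex.re_sum, Matrix.smul_mul,
        Matrix.trace_smul, smul_eq_mul, Complex.re_ofReal_mul]
      simp only [Finset.mul_sum]
      rw [Finset.sum_congr rfl fun a _ => Finset.sum_comm, Finset.sum_comm]
      exact Finset.sum_congr rfl fun x _ => Finset.sum_comm

/-- A distinguisher for Trevisan's extractor yields a step `i` and a fixing of the seed outside
`S i` for which the bits of `C x` at random positions `w` are predicted from `E` and the advice. -/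
theorem exists_advice_predictor {n t r m d : ℕ} {ε : ℝ} (hε : 0 < ε)
    (C : BitStr n → (BitStr t → Bool))
    (S : Fin m → Finset (Fin d)) (hS : IsWeakDesign t r m d S)
    {E : Type*} [Fintype E] [DecidableEq E]
    (p : BitStr n → ℝ) (ρ : BitStr n → Matrix E E ℂ)
    (hfar : ε < traceNorm (extOutputState (trevisanExt C hS) p ρ -
      maxMixed (BitStr m) ⊗ₖ (maxMixed (BitStr d) ⊗ₖ reducedState p ρ))) :
    0 < m ∧ ∃ (y : Fin (r * m) → BitStr t)
      (D : (Fin (r * m) → Bool) → BitStr t → Matrix E E ℂ), (∀ v w, ‖D v w‖ ≤ 1) ∧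
      ε / m < ∑ w, (Fintype.card (BitStr t) : ℝ)⁻¹ * ∑ x, p x *
        (bitSign (C x w) * (ρ x * D (fun q => C x (y q)) w).trace.re) := by
  obtain ⟨K, hK, hlt⟩ := exists_block_contractions _ p ρ hfar
  set f := trevisanExt C hS with hf
  set b : Fin m → BitStr d → ℝ := fun i y => ∑ x, p x * (bitSign (f x y i) *
    (ρ x * bitPredictor (fun a => K a y) i (f x y)).trace.re) with hb
  have hsum : ε < ∑ i, ∑ y, (Fintype.card (BitStr d) : ℝ)⁻¹ * b i y := by
    refine hlt.trans_eq ?_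
    simp only [hb, Finset.mul_sum]
    rw [Finset.sum_comm, Finset.sum_comm (s := (Finset.univ : Finset (Fin m)))]
    refine Finset.sum_congr rfl fun y _ => ?_
    rw [Finset.sum_comm]
    refine Finset.sum_congr rfl fun x _ => ?_
    rw [sub_mean_eq_sum_bitPredictor (fun a => K a y), Matrix.mul_sum, Matrix.trace_sum,
      Complex.re_sum, Finset.mul_sum]
    refine Finset.sum_congr rfl fun i _ => ?_
    rw [Matrix.mul_smul, Matrix.trace_smul, Complex.smul_re, smul_eq_mul]
    ring
  have hm : 0 < m := by
    rcases Nat.eq_zero_or_pos m with rfl | h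
    · rw [Fintype.sum_empty] at hsum
      exact absurd hsum hε.not_gt
    · exact h
  refine ⟨hm, ?_⟩
  have hm' : (m : ℝ) ≠ 0 := by positivity
  obtain ⟨i, -, hi⟩ : ∃ i ∈ (Finset.univ : Finset (Fin m)),
      ε / m < ∑ y, (Fintype.card (BitStr d) : ℝ)⁻¹ * b i y := by
    refine Finset.exists_lt_of_sum_lt (f := fun _ => ε / m) ?_
    rw [Finset.sum_const, Finset.card_univ, Fintype.card_fin, nsmul_eq_mul,
      mul_div_cancel₀ _ hm']
    exact hsum
  obtain ⟨u, hu⟩ := exists_lt_sum_of_lt_sum (S i) (hS.card_eq i) (b i) hi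
  obtain ⟨y, hy⟩ := hS.exists_advice i u
  choose idx hidx using hy
  set e := seedEquiv (S i) (hS.card_eq i) with he
  refine ⟨y, fun v w => bitPredictor (fun a => K a (e.symm (w, u))) i
    fun j => if h : j < i then v (idx w j h) else false,
    fun v w => norm_bitPredictor_le_one (fun a => hK a _) _ _, hu.trans_eq ?_⟩
  refine Finset.sum_congr rfl fun w _ => ?_
  congr 1
  refine Finset.sum_congr rfl fun x _ => ?_
  have h1 : f x (e.symm (w, u)) i = C x w := by
    rw [hf, trevisanExt, he, seedRestrict_seedEquiv_symm]
  rw [h1, bitPredictor_congr (fun a => K a (e.symm (w, u))) i (a := f x (e.symm (w, u)))]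
  intro j hj
  simp only [dif_pos hj, hidx w j hj, hf, trevisanExt, he]

end Distinguisher

/-! ### Decoding by the pretty good measurement -/

theorem bitSign_mul_bitSign (a b : Bool) :
    bitSign a * bitSign b = 1 - 2 * if a ≠ b then 1 else 0 := by
  cases a <;> cases b <;> norm_num [bitSign]

/-- The correlation of two strings is `1 - 2 · relDist`. -/
theorem mean_bitSign_mul_eq {ι : Type*} [Fintype ι] [Nonempty ι] (z c : ι → Bool) :
    ∑ w, (Fintype.card ι : ℝ)⁻¹ * (bitSign (z w) * bitSign (c w)) = 1 - 2 * relDist z c := by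
  have hN : (Fintype.card ι : ℝ) ≠ 0 := by exact_mod_cast Fintype.card_ne_zero
  have h1 : ∑ w, (if z w ≠ c w then (1 : ℝ) else 0) = hammingDist z c := by
    rw [Finset.sum_boole, hammingDist]
  simp only [bitSign_mul_bitSign]
  rw [← Finset.mul_sum, Finset.sum_sub_distrib, ← Finset.mul_sum, h1, relDist]
  simp only [Finset.sum_const, Finset.card_univ, nsmul_eq_mul, mul_one]
  field_simp

open scoped MatrixOrder Matrix.Norms.L2Operator in
theorem re_trace_mul_nonneg {E : Type*} [Fintype E] [DecidableEq E] {A B : Matrix E E ℂ}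
    (hA : A.PosSemidef) (hB : B.PosSemidef) : 0 ≤ ((A * B).trace).re := by
  obtain ⟨R, hR⟩ : ∃ R : Matrix E E ℂ, A = Rᴴ * R :=
    CStarAlgebra.nonneg_iff_eq_star_mul_self.mp hA.nonneg
  have h1 : (A * B).trace = (R * B * Rᴴ).trace := by
    rw [hR, Matrix.mul_assoc, Matrix.trace_mul_comm]
  rw [h1]
  exact (Complex.le_def.1 (hB.mul_mul_conjTranspose_same R).trace_nonneg).1

theorem IsPOVM.sum_re_trace {E O : Type*} [Fintype E] [DecidableEq E] [Fintype O]
    {F : O → Matrix E E ℂ} (hF : IsPOVM F) {σ : Matrix E E ℂ} (hσ : IsDensityMatrix σ) :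
    ∑ o, ((F o * σ).trace).re = 1 := by
  rw [← Complex.re_sum, ← Matrix.trace_sum, ← Finset.sum_mul, hF.sum_eq_one, Matrix.one_mul,
    hσ.trace_eq_one, Complex.one_re]

/-- Relabelling the outcomes of a POVM. -/
theorem IsPOVM.map {E O O' : Type*} [Fintype E] [DecidableEq E] [Fintype O] [Fintype O']
    [DecidableEq O'] {G : O → Matrix E E ℂ} (hG : IsPOVM G) (g : O → O') :
    IsPOVM fun o' => ∑ o, if g o = o' then G o else 0 where
  posSemidef o' := Matrix.posSemidef_sum _ fun o _ => by
    split_ifs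
    · exact hG.posSemidef o
    · exact Matrix.PosSemidef.zero
  sum_eq_one := by
    rw [Finset.sum_comm]
    simpa using hG.sum_eq_one

open scoped Matrix.Norms.L2Operator in
/-- If advice and contractions predict the bits of `c x` at random positions with correlation at
least `β`, then measurements that depend on the advice only, applied before the position is known,
produce strings whose correlation with `c x` is at least `β ^ 2`. -/
theorem exists_povm_sq_le_correlation {X V ι E : Type*} [Fintype X] [DecidableEq V] [Fintype V]
    [Nonempty X] [Fintype ι] [DecidableEq ι] [Nonempty ι] [Fintype E] [DecidableEq E]
    {p : X → ℝ} (hp : IsProbDist p) {ρ : X → Matrix E E ℂ} (hρ : ∀ x, IsDensityMatrix (ρ x))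
    (adv : X → V) (c : X → ι → Bool) (D : V → ι → Matrix E E ℂ) (hD : ∀ v w, ‖D v w‖ ≤ 1) :
    ∃ F : V → (ι → Bool) → Matrix E E ℂ, (∀ v, IsPOVM (F v)) ∧
      (∑ w, (Fintype.card ι : ℝ)⁻¹ * ∑ x, p x *
        (bitSign (c x w) * (ρ x * D (adv x) w).trace.re)) ^ 2 ≤
      ∑ x, ∑ z, p x * (F (adv x) z * ρ x).trace.re * (1 - 2 * relDist z (c x)) := by
  set τ : V → X → Matrix E E ℂ := fun v x => if adv x = v then (p x : ℂ) • ρ x else 0 with hτ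
  have hτpos : ∀ v x, (τ v x).PosSemidef := by
    intro v x
    simp only [hτ]
    split_ifs
    · exact (hρ x).posSemidef.smul (by exact_mod_cast hp.nonneg x)
    · exact Matrix.PosSemidef.zero
  choose G hG hle using fun v => exists_povm_sq_le (hτpos v)
  refine ⟨fun v z => ∑ x, if c x = z then G v x else 0, fun v => (hG v).map c, ?_⟩
  set N : ℝ := (Fintype.card ι : ℝ) with hN
  have hN0 : 0 < N := by rw [hN]; exact_mod_cast Fintype.card_pos
  have hN0' : 0 < N⁻¹ := inv_pos.2 hN0
  set B : V → ι → ℝ := fun v w =>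
    ((∑ x, (bitSign (c x w) : ℂ) • τ v x) * D v w).trace.re with hB
  set Q : V → ι → ℝ := fun v w =>
    ∑ x, ∑ x', bitSign (c x w) * bitSign (c x' w) * (G v x * τ v x').trace.re with hQ
  set T : V → ℝ := fun v => (∑ x, τ v x).trace.re with hT
  have hT0 : ∀ v, 0 ≤ T v := fun v =>
    (Complex.le_def.1 (Matrix.posSemidef_sum _ fun x _ => hτpos v x).trace_nonneg).1
  have hT1 : ∑ v, T v = 1 := by
    simp only [hT, hτ]
    rw [← Complex.re_sum, ← Matrix.trace_sum, Finset.sum_comm]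
    simp only [Finset.sum_ite_eq, Finset.mem_univ, if_true]
    simp only [Matrix.trace_sum, Matrix.trace_smul, (hρ _).trace_eq_one, Complex.re_sum,
      smul_eq_mul, mul_one, Complex.ofReal_re]
    exact hp.sum_eq_one
  have hlhs : ∑ w, N⁻¹ * ∑ x, p x * (bitSign (c x w) * (ρ x * D (adv x) w).trace.re)
      = ∑ vw : V × ι, N⁻¹ * B vw.1 vw.2 := by
    rw [Fintype.sum_prod_type_right]
    refine Finset.sum_congr rfl fun w _ => ?_
    rw [← Finset.mul_sum]
    congr 1
    simp only [hB, hτ, Finset.sum_mul, Matrix.trace_sum, Complex.re_sum, Matrix.smul_mul,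
      Matrix.trace_smul, smul_eq_mul, Complex.re_ofReal_mul]
    rw [Finset.sum_comm]
    refine Finset.sum_congr rfl fun x _ => ?_
    rw [Finset.sum_eq_single (adv x)]
    · rw [if_pos rfl, Matrix.smul_mul, Matrix.trace_smul, smul_eq_mul, Complex.re_ofReal_mul]
      ring
    · intro v _ hv
      rw [if_neg hv.symm]; simp
    · simp
  have hcs : (∑ vw : V × ι, N⁻¹ * B vw.1 vw.2) ^ 2 ≤
      (∑ vw : V × ι, N⁻¹ * Q vw.1 vw.2) * ∑ vw : V × ι, N⁻¹ * T vw.1 := by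
    refine Finset.sum_sq_le_sum_mul_sum_of_sq_le_mul _
      (fun vw _ => mul_nonneg hN0'.le ?_)
      (fun vw _ => mul_nonneg hN0'.le (hT0 _)) fun vw _ => ?_
    · exact ((hle vw.1) (fun x => bitSign (c x vw.2)) _ (hD vw.1 vw.2)).2
    · have h1 := ((hle vw.1) (fun x => bitSign (c x vw.2)) _ (hD vw.1 vw.2)).1
      calc (N⁻¹ * B vw.1 vw.2) ^ 2 = N⁻¹ ^ 2 * B vw.1 vw.2 ^ 2 := by ring
        _ ≤ N⁻¹ ^ 2 * (Q vw.1 vw.2 * T vw.1) := by gcongr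
        _ = _ := by ring
  have hTsum : ∑ vw : V × ι, N⁻¹ * T vw.1 = 1 := by
    rw [Fintype.sum_prod_type_right]
    simp only [← Finset.mul_sum, hT1, Finset.sum_const, Finset.card_univ, nsmul_eq_mul]
    rw [← hN, mul_one, inv_mul_cancel₀ hN0.ne']
  have hQsum : ∑ vw : V × ι, N⁻¹ * Q vw.1 vw.2 =
      ∑ x, ∑ z, p x * ((∑ x', if c x' = z then G (adv x) x' else 0) * ρ x).trace.re *
        (1 - 2 * relDist z (c x)) := by
    have hz : ∀ x, ∑ z, p x * ((∑ x', if c x' = z then G (adv x) x' else 0) * ρ x).trace.re *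
        (1 - 2 * relDist z (c x)) =
        ∑ x', p x * (G (adv x) x' * ρ x).trace.re * (1 - 2 * relDist (c x') (c x)) := by
      intro x
      simp only [Finset.sum_mul, Matrix.trace_sum, Complex.re_sum, Finset.mul_sum]
      rw [Finset.sum_comm]
      refine Finset.sum_congr rfl fun x' _ => ?_
      rw [Finset.sum_eq_single (c x')]
      · rw [if_pos rfl]
      · intro z _ hz
        rw [if_neg hz.symm]; simp
      · simp
    rw [Finset.sum_congr rfl fun x _ => hz x]
    simp only [← mean_bitSign_mul_eq, hQ, Finset.mul_sum]
    have hv : ∀ w x x', ∑ v, N⁻¹ * (bitSign (c x' w) * bitSign (c x w) *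
        (G v x' * τ v x).trace.re) = p x * (G (adv x) x' * ρ x).trace.re *
          (N⁻¹ * (bitSign (c x' w) * bitSign (c x w))) := by
      intro w x x'
      rw [Finset.sum_eq_single (adv x)]
      · simp only [hτ, if_pos]
        rw [Matrix.mul_smul, Matrix.trace_smul, smul_eq_mul, Complex.re_ofReal_mul]
        ring
      · intro v _ hv
        simp only [hτ]
        rw [if_neg hv.symm]; simp
      · simp
    simp only [← hN, ← hv]
    rw [Fintype.sum_prod_type_right]
    calc ∑ w, ∑ v, ∑ x', ∑ x, N⁻¹ * (bitSign (c x' w) * bitSign (c x w) *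
          (G v x' * τ v x).trace.re)
        = ∑ w, ∑ x, ∑ x', ∑ v, N⁻¹ * (bitSign (c x' w) * bitSign (c x w) *
          (G v x' * τ v x).trace.re) := by
          refine Finset.sum_congr rfl fun w _ => ?_
          rw [Finset.sum_congr rfl fun v _ => Finset.sum_comm, Finset.sum_comm]
          exact Finset.sum_congr rfl fun x _ => Finset.sum_comm
      _ = _ := by
          rw [Finset.sum_comm]
          exact Finset.sum_congr rfl fun x _ => Finset.sum_comm
  rw [hlhs, ← hQsum]
  simpa only [hTsum, mul_one] using hcs

/-- Averaging: an expected correlation of `8 δ` forces agreement within relative distance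
`1/2 - δ` with probability at least `δ`. -/
theorem le_eveProb_of_le_correlation {X V ι E : Type*} [Fintype X] [Fintype ι] [DecidableEq ι]
    [Fintype E] [DecidableEq E] {p : X → ℝ} (hp : IsProbDist p) {ρ : X → Matrix E E ℂ}
    (hρ : ∀ x, IsDensityMatrix (ρ x)) (adv : X → V) (c : X → ι → Bool)
    {F : V → (ι → Bool) → Matrix E E ℂ} (hF : ∀ v, IsPOVM (F v)) {δ : ℝ} (hδ : 0 ≤ δ)
    (h : 8 * δ ≤ ∑ x, ∑ z, p x * (F (adv x) z * ρ x).trace.re * (1 - 2 * relDist z (c x))) :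
    δ ≤ eveProb p ρ adv F fun x z => relDist z (c x) ≤ 1 / 2 - δ := by
  classical
  have hw : ∀ x z, 0 ≤ p x * (F (adv x) z * ρ x).trace.re := fun x z =>
    mul_nonneg (hp.nonneg x) (re_trace_mul_nonneg ((hF _).posSemidef z) (hρ x).posSemidef)
  have hw1 : ∑ x, ∑ z, p x * (F (adv x) z * ρ x).trace.re = 1 := by
    simp only [← Finset.mul_sum, (hF _).sum_re_trace (hρ _), mul_one]
    exact hp.sum_eq_one
  have hle : ∑ x, ∑ z, p x * (F (adv x) z * ρ x).trace.re * (1 - 2 * relDist z (c x)) ≤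
      eveProb p ρ adv F (fun x z => relDist z (c x) ≤ 1 / 2 - δ) +
        2 * δ * ∑ x, ∑ z, p x * (F (adv x) z * ρ x).trace.re := by
    unfold eveProb
    simp only [Finset.mul_sum, ← Finset.sum_add_distrib]
    refine Finset.sum_le_sum fun x _ => Finset.sum_le_sum fun z _ => ?_
    have h0 : 0 ≤ relDist z (c x) := by unfold relDist; positivity
    split_ifs with hz
    · nlinarith [hw x z, mul_nonneg (hw x z) h0, mul_nonneg (hw x z) hδ]
    · push Not at hz
      nlinarith [mul_le_mul_of_nonneg_left hz.le (hw x z)]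
  rw [hw1] at hle
  linarith

theorem eveProb_mono {X V O E : Type*} [Fintype X] [Fintype O] [Fintype E] [DecidableEq E]
    {p : X → ℝ} (hp : IsProbDist p) {ρ : X → Matrix E E ℂ}
    (hρ : ∀ x, IsDensityMatrix (ρ x)) (adv : X → V) {F : V → O → Matrix E E ℂ}
    (hF : ∀ v, IsPOVM (F v)) {P Q : X → O → Prop} (h : ∀ x o, P x o → Q x o) :
    eveProb p ρ adv F P ≤ eveProb p ρ adv F Q := by
  classical
  unfold eveProb
  refine Finset.sum_le_sum fun x _ => Finset.sum_le_sum fun o _ => ?_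
  have hw := mul_nonneg (hp.nonneg x)
    (re_trace_mul_nonneg ((hF (adv x)).posSemidef o) (hρ x).posSemidef)
  by_cases hP : P x o
  · rw [if_pos hP, if_pos (h x o hP)]
  · rw [if_neg hP]
    split_ifs
    · exact hw
    · exact le_rfl

/-- An injective list-decodable code has a list decoder: the messages whose codewords lie in the
ball around `z` are at most `L` many. -/
theorem IsListDecodable.exists_decoder {n : ℕ} {ι : Type*} [Fintype ι]
    {C : BitStr n → (ι → Bool)} {δ : ℝ} {L : ℕ} (hC : IsListDecodable C δ L)
    (hinj : Function.Injective C) :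
    ∃ dec : (ι → Bool) → Fin L → BitStr n,
      ∀ x z, relDist z (C x) ≤ 1 / 2 - δ → ∃ i, dec z i = x := by
  classical
  have hz : ∀ z : ι → Bool, ∃ l : Fin L → BitStr n,
      ∀ x, relDist z (C x) ≤ 1 / 2 - δ → ∃ i, l i = x := by
    intro z
    obtain ⟨l, hl⟩ := Finset.exists_fin_fun_of_card_le (N := L)
      (Finset.univ.filter fun x => relDist z (C x) ≤ 1 / 2 - δ) (by
        refine le_trans ?_ (hC z)
        rw [← Set.ncard_coe_finset, ← Set.ncard_image_of_injective _ hinj]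
        refine Set.ncard_le_ncard ?_ (Set.toFinite _)
        rintro _ ⟨x, hx, rfl⟩
        exact ⟨Set.mem_range_self x, by simpa using hx⟩)
    exact ⟨l, fun x hx => hl x (by simpa using hx)⟩
  choose dec hdec using hz
  exact ⟨dec, fun x z => hdec z x⟩

theorem mainTheorem6
    (n m r t d L : ℕ) (ε : ℝ) (hε : 0 < ε)
    (C : BitStr n → (BitStr t → Bool))
    (hC : IsListDecodable C (ε ^ 2 / (8 * (m : ℝ) ^ 2)) L)
    (S : Fin m → Finset (Fin d)) (hS : IsWeakDesign t r m d S)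
    {E : Type*} [Fintype E] [DecidableEq E]
    (p : BitStr n → ℝ) (hp : IsProbDist p)
    (ρ : BitStr n → Matrix E E ℂ) (hρ : ∀ x, IsDensityMatrix (ρ x))
    (hfar : ε < traceNorm (extOutputState (trevisanExt C hS) p ρ -
      maxMixed (BitStr m) ⊗ₖ (maxMixed (BitStr d) ⊗ₖ reducedState p ρ))) :
    ∃ (y : Fin (r * m) → BitStr t)
      (F : (Fin (r * m) → Bool) → (BitStr t → Bool) → Matrix E E ℂ),
      (∀ v, IsPOVM (F v)) ∧
      ε ^ 2 / (8 * (m : ℝ) ^ 2) ≤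
        eveProb p ρ (fun x i => C x (y i)) F
          (fun x z => relDist z (C x) ≤ 1 / 2 - ε ^ 2 / (8 * (m : ℝ) ^ 2)) ∧
      (Function.Injective C →
        ∃ dec : (BitStr t → Bool) → Fin L → BitStr n,
          (∀ x z, relDist z (C x) ≤ 1 / 2 - ε ^ 2 / (8 * (m : ℝ) ^ 2) → ∃ i, dec z i = x) ∧
          ε ^ 2 / (8 * (m : ℝ) ^ 2) ≤
            eveProb p ρ (fun x i => C x (y i)) F (fun x z => ∃ i, dec z i = x)) := by
  obtain ⟨hm, y, D, hD, hpred⟩ := exists_advice_predictor hε C S hS p ρ hfar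
  obtain ⟨F, hF, hcorr⟩ := exists_povm_sq_le_correlation hp hρ (fun x i => C x (y i)) C D hD
  have hm' : (0 : ℝ) < m := by exact_mod_cast hm
  have hdecode : ε ^ 2 / (8 * (m : ℝ) ^ 2) ≤ eveProb p ρ (fun x i => C x (y i)) F
      (fun x z => relDist z (C x) ≤ 1 / 2 - ε ^ 2 / (8 * (m : ℝ) ^ 2)) := by
    refine le_eveProb_of_le_correlation hp hρ _ C hF (by positivity) (le_trans ?_ hcorr)
    have h1 : 8 * (ε ^ 2 / (8 * (m : ℝ) ^ 2)) = (ε / m) ^ 2 := by field_simp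
    rw [h1]
    exact pow_le_pow_left₀ (by positivity) hpred.le 2
  refine ⟨y, F, hF, hdecode, fun hinj => ?_⟩
  obtain ⟨dec, hdec⟩ := hC.exists_decoder hinj
  exact ⟨dec, hdec, hdecode.trans (eveProb_mono hp hρ _ hF hdec)⟩
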